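/- \textbf{Proposition.} Let $c>0$ and $p>0$ be fixed, and let $k=\lfloor p\rfloor+1$. For each integer $n>p$, let $G_n$ be a random graph with distribution $\mathrm{G}(n,p/n)$, that is, a simple graph on $n$ labeled vertices in which each pair of distinct vertices is joined by an edge with probability $p/n$, independently of all other pairs. Let $A_n$ be the adjacency matrix of $G_n$, and let $D_n$ be the diagonal matrix whose diagonal is the vector $c\,1_n+A_n1_n$, where $1_n$ is the column vector of $n$ ones (so the $i$-th diagonal entry of $D_n$ is $c$ plus the degree of vertex $i$). For a square matrix $M$ let $\mathrm{sr}(M)=\max|\lambda|$, the maximum being over the eigenvalues $\lambda$ of $M$, and for $x\ge 0$ let $\tau_x=1/\sqrt{1+x}$. Then $$\mathrm{P}\left\{\mathrm{sr}(D_n^{-1}A_n)\le\tau_{c/k}\right\}\to 1\qquad\text{as } n\to\infty.$$ -/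

import Mathlib

open Filter Topology MeasureTheory

/-- The spectral radius `sr(M) = max |λ|` over all (complex) eigenvalues `λ` of a real square
matrix `M`, as an extended nonnegative real. -/
noncomputable def realMatrixSpectralRadius {V : Type*} [Fintype V] [DecidableEq V]
    (M : Matrix V V ℝ) : ENNReal :=
  spectralRadius ℂ (M.map (fun x : ℝ => (x : ℂ)))

open Classical in
/-- The diagonal matrix `D` whose diagonal is the vector `c 1 + A 1`, where `A` is the adjacency
matrix of `G`; the entry at `u` is `c + deg u`. -/
noncomputable def regularizedDegreeMatrix {V : Type*} [Fintype V] (c : ℝ) (G : SimpleGraph V) :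
    Matrix V V ℝ :=
  Matrix.diagonal (c • (1 : V → ℝ) + Matrix.mulVec (G.adjMatrix ℝ) 1)

open Classical in
/-- The matrix `K = D⁻¹ A`, with `A` the adjacency matrix of `G` and `D` the diagonal matrix with
diagonal `c 1 + A 1`. For `c > 0` the matrix `D` is invertible. -/
noncomputable def regularizedWalkMatrix {V : Type*} [Fintype V] (c : ℝ) (G : SimpleGraph V) :
    Matrix V V ℝ :=
  (regularizedDegreeMatrix c G)⁻¹ * G.adjMatrix ℝ

/-- `τ_c = 1 / √(1 + c)`. -/
noncomputable def tauBound (c : ℝ) : ℝ := 1 / Real.sqrt (1 + c)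

/-- The edge probability `p / n`, as an element of the unit interval. It is `p / n` itself
as soon as `n ≥ p > 0`; otherwise it is clamped to `[0, 1]`, which does not affect limits
as `n → ∞`. -/
noncomputable def edgeProb (p : ℝ) (n : ℕ) : unitInterval :=
  Set.projIcc (0 : ℝ) 1 zero_le_one (p / n)

/-! Suppose the edges can be oriented with out-degrees at most `k`. With `0 < l ≤ 1`, apply the
weighted inequality `2ab ≤ s a² + t b²`, `s t ≥ 1`, to each edge, weighting its tail by `l⁻¹` and
its head by `l`. This gives `xᵀAx ≤ ∑ (l deg u + (l⁻¹ - l) k) x_u²` for `x ≥ 0`, and `l = τ_{c/k}`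
turns the right side into `l xᵀDx`. Testing with the moduli of an eigenvector of `D⁻¹A` bounds every
eigenvalue by `l` (`spectralRadius_le_tauBound_of_orientable`).

It remains to orient the random graph. Choose `q` with `1 - (1 - q)^k = p/n`: then `G(n, p/n)` is a
union of `k` independent copies of `G(n, q)`, and out-degrees add under unions. Since `p/k < 1`,
each copy is subcritical: eventually `n q ≤ r < 1`. By Hall's theorem, a graph with no orientation
of out-degree at most one has a subgraph with more edges than vertices, hence a bicyclic path. A
first-moment count shows that such a path exists in a copy with probability `O(1/n)`. -/

/-! ### Orientations and the spectral bound. -/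

/-- `G` admits a relation covering every edge in which each vertex has at most `k` out-neighbours;
equivalently, the edges can be oriented with all out-degrees at most `k`. -/
def SimpleGraph.IsOrientable {V : Type*} (G : SimpleGraph V) (k : ℕ) : Prop :=
  ∃ r : V → V → Prop, (∀ u v, G.Adj u v → r u v ∨ r v u) ∧ ∀ u, {v | r u v}.encard ≤ k

theorem mul_le_of_weights {a b s t : ℝ} (ha : 0 ≤ a) (hb : 0 ≤ b) (hs : 0 ≤ s)
    (ht : 0 ≤ t) (hst : 1 ≤ s * t) : 2 * (a * b) ≤ s * a ^ 2 + t * b ^ 2 := by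
  have h1 : (1 : ℝ) ≤ √s * √t := by
    rw [← Real.sqrt_mul hs]; exact Real.one_le_sqrt.2 hst
  have h2 := sq_nonneg (√s * a - √t * b)
  have h3 := Real.sq_sqrt hs
  have h4 := Real.sq_sqrt ht
  have h5 : a * b ≤ (√s * √t) * (a * b) := le_mul_of_one_le_left (mul_nonneg ha hb) h1
  nlinarith

open Classical in
theorem orientable_quadratic_form_le {V : Type*} [Fintype V] {G : SimpleGraph V} {k : ℕ}
    (hG : G.IsOrientable k) {l : ℝ} (hl : 0 < l) (hl1 : l ≤ 1) (x : V → ℝ) (hx : ∀ v, 0 ≤ x v) :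
    ∑ u, ∑ v, G.adjMatrix ℝ u v * (x u * x v) ≤
      ∑ u, (l * G.degree u + (l⁻¹ - l) * k) * x u ^ 2 := by
  obtain ⟨r, hr, hk⟩ := hG
  -- The weight is `l⁻¹` along `r` and `l` otherwise. It is always at least `l`, so the two weights
  -- of an edge have product at least `1`, even if `r` holds both ways.
  set w : V → V → ℝ := fun u v => l + if r u v then l⁻¹ - l else 0 with hw
  have hinv : 1 ≤ l⁻¹ := (one_le_inv₀ hl).2 hl1
  have hwl : ∀ u v, l ≤ w u v := fun u v => by
    simp only [hw]; split_ifs <;> linarith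
  have hw1 : ∀ u v, G.Adj u v → 1 ≤ w u v * w v u := by
    intro u v h
    have key : ∀ u v, r u v → 1 ≤ w u v * w v u := by
      intro u v h
      have : w u v = l⁻¹ := by simp [hw, h]
      rw [this, ← inv_mul_cancel₀ hl.ne']
      exact mul_le_mul_of_nonneg_left (hwl v u) (by positivity)
    rcases hr u v h with h | h
    · exact key _ _ h
    · rw [mul_comm]; exact key _ _ h
  have h1 : 2 * ∑ u, ∑ v, G.adjMatrix ℝ u v * (x u * x v) ≤
      ∑ u, ∑ v, G.adjMatrix ℝ u v * (w u v * x u ^ 2) +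
      ∑ u, ∑ v, G.adjMatrix ℝ u v * (w v u * x v ^ 2) := by
    rw [Finset.mul_sum, ← Finset.sum_add_distrib]
    refine Finset.sum_le_sum fun u _ => ?_
    rw [Finset.mul_sum, ← Finset.sum_add_distrib]
    refine Finset.sum_le_sum fun v _ => ?_
    rw [SimpleGraph.adjMatrix_apply]
    split_ifs with h
    · have := mul_le_of_weights (hx u) (hx v) (hl.le.trans (hwl u v)) (hl.le.trans (hwl v u))
        (hw1 u v h)
      linarith
    · simp
  have h2 : ∑ u, ∑ v, G.adjMatrix ℝ u v * (w v u * x v ^ 2) =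
      ∑ u, ∑ v, G.adjMatrix ℝ u v * (w u v * x u ^ 2) := by
    rw [Finset.sum_comm]
    refine Finset.sum_congr rfl fun u _ => Finset.sum_congr rfl fun v _ => ?_
    simp only [SimpleGraph.adjMatrix_apply, G.adj_comm]
  have h3 : ∑ u, ∑ v, G.adjMatrix ℝ u v * (w u v * x u ^ 2) ≤
      ∑ u, (l * G.degree u + (l⁻¹ - l) * k) * x u ^ 2 := by
    refine Finset.sum_le_sum fun u _ => ?_
    have e : ∑ v, G.adjMatrix ℝ u v * (w u v * x u ^ 2) =
        (∑ v, G.adjMatrix ℝ u v * w u v) * x u ^ 2 := by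
      rw [Finset.sum_mul]; exact Finset.sum_congr rfl fun v _ => by ring
    rw [e]
    refine mul_le_mul_of_nonneg_right ?_ (sq_nonneg _)
    calc ∑ v, G.adjMatrix ℝ u v * w u v
        ≤ ∑ v, (G.adjMatrix ℝ u v * l + if r u v then l⁻¹ - l else 0) := by
          refine Finset.sum_le_sum fun v _ => ?_
          rw [SimpleGraph.adjMatrix_apply]
          simp only [hw]
          split_ifs <;> linarith
      _ = l * G.degree u + (l⁻¹ - l) * ({v | r u v} : Finset V).card := by
          rw [Finset.sum_add_distrib, ← Finset.sum_mul, ← Finset.sum_filter, Finset.sum_const,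
            nsmul_eq_mul]
          have : ∑ v, G.adjMatrix ℝ u v = G.degree u := by
            simp [SimpleGraph.adjMatrix_apply, ← SimpleGraph.card_neighborFinset_eq_degree,
              SimpleGraph.neighborFinset_eq_filter]
          rw [this]; ring
      _ ≤ _ := by
          have hc : ({v | r u v} : Finset V).card ≤ k := by
            have := hk u
            rw [Set.encard_eq_coe_toFinset_card] at this
            have h' := Nat.cast_le.1 this
            convert h' using 2
            ext; simp
          have : (({v | r u v} : Finset V).card : ℝ) ≤ k := by exact_mod_cast hc
          nlinarith
  linarith

theorem spectralRadius_le_tauBound_of_orientable {V : Type*} [Fintype V] [DecidableEq V]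
    {G : SimpleGraph V}
    {k : ℕ} (hk : 0 < k) (hG : G.IsOrientable k) {c : ℝ} (hc : 0 < c) :
    realMatrixSpectralRadius (regularizedWalkMatrix c G) ≤
      ENNReal.ofReal (tauBound (c / (k : ℝ))) := by
  classical
  have hk' : (0 : ℝ) < k := by exact_mod_cast hk
  have hck : 0 < c / k := by positivity
  set l := tauBound (c / k) with hldef
  have hs : 0 < √(1 + c / k) := Real.sqrt_pos.2 (by linarith)
  have hl : 0 < l := by simp only [hldef, tauBound]; positivity
  have hl1 : l ≤ 1 := by
    simp only [hldef, tauBound]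
    rw [div_le_one hs]; exact Real.one_le_sqrt.2 (by linarith)
  -- This identity dictates the value of `l`: it says `l⁻² = 1 + c / k`.
  have hlk : (l⁻¹ - l) * k = l * c := by
    have : l⁻¹ = √(1 + c / k) := by simp [hldef, tauBound]
    have h2 : l⁻¹ = l * (1 + c / k) := by
      rw [← Real.sq_sqrt (show 0 ≤ 1 + c / k by linarith), ← this]; field_simp
    rw [h2]; field_simp; ring
  set d : V → ℝ := fun u => c + G.degree u with hd
  have hdpos : ∀ u, 0 < d u := fun u => by simp only [hd]; positivity
  have hD : regularizedDegreeMatrix c G = Matrix.diagonal d := by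
    have : c • (1 : V → ℝ) + (G.adjMatrix ℝ).mulVec 1 = d := by
      ext u
      simp [hd, SimpleGraph.adjMatrix_mulVec_apply]
    rw [← this, regularizedDegreeMatrix]
    congr!
  have hK : ∀ u v, regularizedWalkMatrix c G u v = (d u)⁻¹ * G.adjMatrix ℝ u v := by
    intro u v
    have hinv : (Matrix.diagonal d)⁻¹ = Matrix.diagonal (fun u => (d u)⁻¹) := by
      apply Matrix.inv_eq_left_inv
      rw [Matrix.diagonal_mul_diagonal, ← Matrix.diagonal_one]
      congr 1; ext u; exact inv_mul_cancel₀ (hdpos u).ne'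
    have : regularizedWalkMatrix c G = (Matrix.diagonal d)⁻¹ * G.adjMatrix ℝ := by
      unfold regularizedWalkMatrix
      rw [hD]
      congr!
    rw [this, hinv, Matrix.diagonal_mul]
  unfold realMatrixSpectralRadius
  refine iSup₂_le fun μ hμ => ?_
  rw [← Matrix.spectrum_toLin', ← Module.End.hasEigenvalue_iff_mem_spectrum] at hμ
  obtain ⟨z, hz⟩ := hμ.exists_hasEigenvector
  have hz0 := hz.2
  have hev : ∀ u, ∑ v, (regularizedWalkMatrix c G u v : ℂ) * z v = μ * z u := by
    intro u
    have := congrFun hz.apply_eq_smul u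
    simpa [Matrix.toLin'_apply, Matrix.mulVec, dotProduct] using this
  have hpt : ∀ u, ‖μ‖ * (d u * ‖z u‖ ^ 2) ≤ ∑ v, G.adjMatrix ℝ u v * (‖z u‖ * ‖z v‖) := by
    intro u
    have h1 : ‖μ‖ * ‖z u‖ ≤ ∑ v, (d u)⁻¹ * G.adjMatrix ℝ u v * ‖z v‖ := by
      rw [← norm_mul, ← hev u]
      refine (norm_sum_le _ _).trans (Finset.sum_le_sum fun v _ => ?_)
      rw [norm_mul, Complex.norm_real, hK, Real.norm_of_nonneg]
      refine mul_nonneg (inv_nonneg.2 (hdpos u).le) ?_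
      rw [SimpleGraph.adjMatrix_apply]; split_ifs <;> norm_num
    have h2 := mul_le_mul_of_nonneg_left h1 (mul_nonneg (hdpos u).le (norm_nonneg (z u)))
    rw [Finset.mul_sum] at h2
    calc ‖μ‖ * (d u * ‖z u‖ ^ 2) = d u * ‖z u‖ * (‖μ‖ * ‖z u‖) := by ring
      _ ≤ _ := h2
      _ = _ := Finset.sum_congr rfl fun v _ => by
        have := (hdpos u).ne'
        field_simp
  have hq := orientable_quadratic_form_le hG hl hl1 (fun v => ‖z v‖) (fun v => norm_nonneg _)
  have hsum : ‖μ‖ * ∑ u, d u * ‖z u‖ ^ 2 ≤ l * ∑ u, d u * ‖z u‖ ^ 2 := by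
    rw [Finset.mul_sum]
    refine (Finset.sum_le_sum fun u _ => hpt u).trans ?_
    refine hq.trans_eq ?_
    rw [Finset.mul_sum]
    refine Finset.sum_congr rfl fun u _ => ?_
    rw [hlk]; simp only [hd]; ring
  have hpos : 0 < ∑ u, d u * ‖z u‖ ^ 2 := by
    obtain ⟨u, hu⟩ := Function.ne_iff.1 hz0
    refine Finset.sum_pos' (fun v _ => mul_nonneg (hdpos v).le (sq_nonneg _))
      ⟨u, Finset.mem_univ _, mul_pos (hdpos u) (pow_pos (norm_pos_iff.2 hu) 2)⟩
  have := le_of_mul_le_mul_right hsum hpos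
  rw [← enorm_eq_nnnorm, ← ofReal_norm]
  exact ENNReal.ofReal_le_ofReal this

/-! ### Bicyclic paths as obstructions to out-degree one. -/

/-- A path each of whose two ends is joined to a vertex of the path by an edge outside the path,
the two additional edges being distinct. -/
def SimpleGraph.HasBicyclicPath {V : Type*} (G : SimpleGraph V) : Prop :=
  ∃ (a b : V) (w : G.Walk a b) (x y : V), w.IsPath ∧ x ∈ w.support ∧ y ∈ w.support ∧
    G.Adj a x ∧ G.Adj b y ∧ s(a, x) ∉ w.edges ∧ s(b, y) ∉ w.edges ∧ s(a, x) ≠ s(b, y)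

theorem SimpleGraph.HasBicyclicPath.mono {V : Type*} {G H : SimpleGraph V} (h : G ≤ H)
    (hG : G.HasBicyclicPath) : H.HasBicyclicPath := by
  obtain ⟨a, b, w, x, y, hw, hx, hy, hax, hby, h1, h2, h3⟩ := hG
  refine ⟨a, b, w.mapLe h, x, y, hw.mapLe h, ?_, ?_, h hax, h hby, ?_, ?_, h3⟩ <;> simpa

theorem Nat.exists_greatest_of_bounded (P : ℕ → Prop) (N : ℕ) (hb : ∀ n, P n → n ≤ N)
    (hex : ∃ n, P n) : ∃ n, P n ∧ ∀ m, P m → m ≤ n := by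
  classical
  obtain ⟨n, hn⟩ := hex
  exact ⟨Nat.findGreatest P N, Nat.findGreatest_spec (hb n hn) hn,
    fun m hm => Nat.le_findGreatest (hb m hm) hm⟩

/-- A longest path from `w` has all neighbours of its far end on it, and there is no leaf, so that
end closes up. If the third direction at `w` leaves the path, extending maximally backwards closes
the other end too. -/
theorem SimpleGraph.hasBicyclicPath_of_branching {V : Type*} [Fintype V] {H : SimpleGraph V}
    (hdeg : ∀ v u, H.Adj v u → ∃ u', u' ≠ u ∧ H.Adj v u')
    {w : V} (hw : ∀ u₁ u₂, ∃ x, H.Adj w x ∧ x ≠ u₁ ∧ x ≠ u₂) : H.HasBicyclicPath := by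
  obtain ⟨n, ⟨b, p, hp, rfl⟩, hmax⟩ := Nat.exists_greatest_of_bounded
    (fun n => ∃ (b : V) (p : H.Walk w b), p.IsPath ∧ p.length = n) (Fintype.card V)
    (by rintro n ⟨b, p, hp, rfl⟩; exact hp.length_lt.le) ⟨0, w, .nil, .nil, rfl⟩
  have hclosed : ∀ v, H.Adj b v → v ∈ p.support := by
    intro v hv
    by_contra hvp
    have := hmax _ ⟨v, p.concat hv, hp.concat hvp hv, rfl⟩
    simp at this
  have hnil : ¬ p.Nil := by
    intro hn
    obtain ⟨x, hx, -⟩ := hw w w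
    have hwb := hn.eq
    subst hwb
    have h1 := hclosed x hx
    rw [SimpleGraph.Walk.nil_iff_support_eq.1 hn] at h1
    simp only [List.mem_singleton] at h1
    exact hx.ne h1.symm
  have hwb : w ≠ b := by
    rintro rfl
    exact hnil (SimpleGraph.Walk.isPath_iff_nil.1 hp)
  obtain ⟨y, hyp, hby⟩ := hdeg b p.penultimate (p.adj_penultimate hnil).symm
  have hyedge : s(b, y) ∉ p.edges := fun h => hyp
    (hp.eq_penultimate_of_mem_edges h)
  -- Avoiding `p.snd` keeps the edge off the path; avoiding `b` makes it differ from `s(b, y)`.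
  obtain ⟨x, hwx, hxs, hxb⟩ := hw p.snd b
  by_cases hx : x ∈ p.support
  · refine ⟨w, b, p, x, y, hp, hx, hclosed y hby, hwx, hby,
      fun h => hxs (hp.eq_snd_of_mem_edges h), hyedge, fun h => ?_⟩
    rcases Sym2.eq_iff.1 h with ⟨h1, -⟩ | ⟨-, h1⟩
    · exact hwb h1
    · exact hxb h1
  -- Keeping `a` off `p` guarantees that the two closing edges are distinct, as `b` and `y` lie on
  -- `p`.
  obtain ⟨n, ⟨a, q, hq, hqnil, rfl⟩, hqmax⟩ := Nat.exists_greatest_of_bounded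
    (fun n => ∃ (a : V) (q : H.Walk a w), (q.append p).IsPath ∧ a ∉ p.support ∧ q.length = n)
    (Fintype.card V)
    (by rintro n ⟨a, q, hq, -, rfl⟩; exact (hq.of_append_left).length_lt.le)
    ⟨1, x, .cons hwx.symm .nil, by simpa using ⟨hp, hx⟩, hx, rfl⟩
  have haclosed : ∀ v, H.Adj a v → v ∈ (q.append p).support := by
    intro v hv
    by_contra hvp
    have h1 := hqmax _ ⟨v, q.cons hv.symm,
      by rw [SimpleGraph.Walk.cons_append, SimpleGraph.Walk.cons_isPath_iff]; exact ⟨hq, hvp⟩,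
      fun h => hvp (by simp [h]), rfl⟩
    simp at h1
  have hqpnil : ¬ (q.append p).Nil := by simp [hnil]
  obtain ⟨z, hzs, haz⟩ := hdeg a (q.append p).snd ((q.append p).adj_snd hqpnil)
  have hysupp := hclosed y hby
  refine ⟨a, b, q.append p, z, y, hq, haclosed z haz, by simp [hysupp], haz, hby,
    fun h => hzs (hq.eq_snd_of_mem_edges h), fun h => ?_, fun h => ?_⟩
  · rw [SimpleGraph.Walk.edges_append, List.mem_append] at h
    rcases h with h | h
    · exact hq.ne_of_mem_support_of_append hwb.symm (x := b) (y := b)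
        (q.fst_mem_support_of_mem_edges h) p.end_mem_support rfl
    · exact hyedge h
  · rcases Sym2.eq_iff.1 h with ⟨h1, -⟩ | ⟨h1, -⟩
    · exact hqnil (h1 ▸ p.end_mem_support)
    · exact hqnil (h1 ▸ hysupp)

-- Deleting a leaf removes one edge and at least one support vertex, so the excess of edges
-- survives. Without leaves, the excess forces a vertex of degree at least three by the handshake
-- lemma.
open Classical in
theorem SimpleGraph.hasBicyclicPath_of_card_support_lt {V : Type*} [Fintype V] (n : ℕ) :
    ∀ H : SimpleGraph V, H.edgeSet.ncard = n → H.support.ncard < n → H.HasBicyclicPath := by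
  induction n with
  | zero => intro H _ h; simp at h
  | succ n ih =>
    intro H hn hlt
    rw [← H.coe_edgeFinset, Set.ncard_coe_finset] at hn
    by_cases hdeg : ∃ v, H.degree v = 1
    · obtain ⟨v, hv⟩ := hdeg
      refine (ih (H.deleteIncidenceSet v) ?_ ?_).mono (H.deleteIncidenceSet_le v)
      · have := H.card_edgeFinset_deleteIncidenceSet v
        rw [hv, hn] at this
        rw [← SimpleGraph.coe_edgeFinset, Set.ncard_coe_finset, this, Nat.add_sub_cancel]
      · have hvs : v ∈ H.support := by
          rw [SimpleGraph.mem_support]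
          obtain ⟨u, hu⟩ := (H.degree_pos_iff_exists_adj v).1 (by omega)
          exact ⟨u, hu⟩
        have : (H.deleteIncidenceSet v).support ⊆ H.support \ {v} := by
          intro u hu
          obtain ⟨t, ht⟩ := (SimpleGraph.mem_support _).1 hu
          rw [SimpleGraph.deleteIncidenceSet_adj] at ht
          exact ⟨⟨t, ht.1⟩, ht.2.1⟩
        have h1 := Set.ncard_le_ncard this (Set.toFinite _)
        have h2 := Set.ncard_sdiff_singleton_add_one hvs (Set.toFinite _)
        omega
    · push Not at hdeg
      have hbig : ∃ w, 3 ≤ H.degree w := by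
        by_contra! hcon
        rw [Set.ncard_eq_toFinset_card'] at hlt
        have h1 := H.sum_degrees_eq_twice_card_edges
        have h2 : ∑ v, H.degree v ≤ ∑ v ∈ H.support.toFinset, 2 := by
          rw [← Finset.sum_subset (Finset.subset_univ H.support.toFinset)]
          · exact Finset.sum_le_sum fun v _ => by have := hcon v; omega
          · intro v _ hv
            by_contra h0
            apply hv
            obtain ⟨u, hu⟩ := (H.degree_pos_iff_exists_adj v).1 (Nat.pos_of_ne_zero h0)
            exact Set.mem_toFinset.2 ⟨u, hu⟩
        rw [Finset.sum_const, smul_eq_mul] at h2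
        omega
      obtain ⟨w, hw⟩ := hbig
      refine SimpleGraph.hasBicyclicPath_of_branching (w := w) ?_ ?_
      · intro v u huv
        have h1 : 1 < (H.neighborFinset v).card := by
          rw [H.card_neighborFinset_eq_degree]
          have := (H.degree_pos_iff_exists_adj v).2 ⟨u, huv⟩
          have := hdeg v
          omega
        obtain ⟨u', hu', hne⟩ := Finset.exists_mem_ne h1 u
        exact ⟨u', hne, (H.mem_neighborFinset _ _).1 hu'⟩
      · intro u₁ u₂
        have h1 : ((H.neighborFinset w) \ {u₁, u₂}).Nonempty := by
          rw [← Finset.card_pos]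
          have := Finset.le_card_sdiff {u₁, u₂} (H.neighborFinset w)
          have h2 := Finset.card_le_two (a := u₁) (b := u₂)
          rw [H.card_neighborFinset_eq_degree] at this
          omega
        obtain ⟨x, hx⟩ := h1
        simp only [Finset.mem_sdiff, SimpleGraph.mem_neighborFinset, Finset.mem_insert,
          Finset.mem_singleton, not_or] at hx
        exact ⟨x, hx.1, hx.2.1, hx.2.2⟩

/-- Hall's theorem assigns to each edge one of its endpoints, injectively; orient every edge out of
its assigned endpoint. A violation of Hall's condition is a subgraph with more edges than vertices.
-/
theorem SimpleGraph.isOrientable_one_of_not_hasBicyclicPath {V : Type*} [Fintype V]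
    {G : SimpleGraph V} (hG : ¬ G.HasBicyclicPath) : G.IsOrientable 1 := by
  classical
  have hall : ∀ F : Finset G.edgeSet,
      F.card ≤ (F.biUnion fun e => e.1.toFinset).card := by
    intro F
    by_contra! hlt
    apply hG
    set S : Finset (Sym2 V) := F.map (Function.Embedding.subtype _) with hS
    have hSG : ∀ e ∈ S, e ∈ G.edgeSet := by
      intro e he
      obtain ⟨e', -, rfl⟩ := Finset.mem_map.1 he
      exact e'.2
    have hedge : (SimpleGraph.fromEdgeSet (S : Set (Sym2 V))).edgeSet = S := by
      rw [SimpleGraph.edgeSet_fromEdgeSet, sdiff_eq_left, Set.disjoint_left]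
      exact fun e he => G.not_isDiag_of_mem_edgeSet (hSG e he)
    have hle : SimpleGraph.fromEdgeSet (S : Set (Sym2 V)) ≤ G := by
      rw [← SimpleGraph.edgeSet_subset_edgeSet, hedge]; exact hSG
    have hcard : (SimpleGraph.fromEdgeSet (S : Set (Sym2 V))).edgeSet.ncard = F.card := by
      rw [hedge, Set.ncard_coe_finset, hS, Finset.card_map]
    refine (SimpleGraph.hasBicyclicPath_of_card_support_lt _ _ hcard ?_).mono hle
    refine lt_of_le_of_lt ?_ hlt
    rw [← Set.ncard_coe_finset]
    refine Set.ncard_le_ncard ?_ (Set.toFinite _)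
    intro v hv
    obtain ⟨u, hu⟩ := (SimpleGraph.mem_support _).1 hv
    have hu' := (SimpleGraph.fromEdgeSet_adj _).1 hu
    obtain ⟨e, he, heq⟩ := Finset.mem_map.1 (Finset.mem_coe.1 hu'.1)
    refine Finset.mem_coe.2 <| Finset.mem_biUnion.2 ⟨e, he, ?_⟩
    rw [Sym2.mem_toFinset]
    have : e.1 = s(v, u) := heq
    rw [this]; simp
  obtain ⟨f, hf, hft⟩ :=
    (Finset.all_card_le_biUnion_card_iff_exists_injective
      (fun e : G.edgeSet => e.1.toFinset)).1 hall
  refine ⟨fun u v => ∃ e : G.edgeSet, e.1 = s(u, v) ∧ f e = u, fun u v h => ?_, fun u => ?_⟩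
  · have := hft ⟨s(u, v), h⟩
    rw [Sym2.mem_toFinset] at this
    rcases Sym2.mem_iff.1 this with h1 | h1
    · exact Or.inl ⟨_, rfl, h1⟩
    · exact Or.inr ⟨_, Sym2.eq_swap, h1⟩
  · rw [Nat.cast_one, Set.encard_le_one_iff]
    rintro v v' ⟨e, he, hv⟩ ⟨e', he', hv'⟩
    have := hf (hv.trans hv'.symm)
    rw [← this, he] at he'
    exact Sym2.congr_right.1 he'

/-! ### First-moment bound for bicyclic paths. -/

open Classical in
/-- The edges of the sequence `f` of vertices, together with the edges joining its first entry
to the `i`-th and its last entry to the `j`-th. -/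
noncomputable def bicyclicEdges {V : Type*} {m : ℕ} (f : Fin (m + 1) → V) (i j : Fin (m + 1)) :
    Finset (Sym2 V) :=
  insert s(f 0, f i) (insert s(f (Fin.last m), f j)
    (Finset.univ.image fun t : Fin m => s(f t.castSucc, f t.succ)))

theorem SimpleGraph.HasBicyclicPath.exists_bicyclicEdges {V : Type*} {G : SimpleGraph V}
    (hG : G.HasBicyclicPath) : ∃ (m : ℕ) (x : (Fin (m + 1) → V) × Fin (m + 1) × Fin (m + 1)),
      (bicyclicEdges x.1 x.2.1 x.2.2).card = m + 2 ∧
        ∀ e ∈ bicyclicEdges x.1 x.2.1 x.2.2, e ∈ G.edgeSet := by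
  classical
  obtain ⟨a, b, w, x, y, hw, hx, hy, hax, hby, h1, h2, h3⟩ := hG
  obtain ⟨i, hi, hile⟩ := SimpleGraph.Walk.mem_support_iff_exists_getVert.1 hx
  obtain ⟨j, hj, hjle⟩ := SimpleGraph.Walk.mem_support_iff_exists_getVert.1 hy
  refine ⟨w.length, ⟨fun t => w.getVert t, ⟨i, by omega⟩, ⟨j, by omega⟩⟩, ?_⟩
  have himg : (Finset.univ.image fun t : Fin w.length =>
      s(w.getVert t.castSucc, w.getVert t.succ)) = w.edges.toFinset := by
    ext e
    induction e with | _ u v =>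
    simp only [Finset.mem_image, Finset.mem_univ, true_and, List.mem_toFinset,
      SimpleGraph.Walk.mk_mem_edges_iff_exists]
    constructor
    · rintro ⟨t, ht⟩; exact ⟨t, t.2, by simpa using ht⟩
    · rintro ⟨t, ht, h⟩; exact ⟨⟨t, ht⟩, by simpa using h⟩
  have hE : bicyclicEdges (fun t : Fin (w.length + 1) => w.getVert t) ⟨i, by omega⟩
      ⟨j, by omega⟩ = insert s(a, x) (insert s(b, y) w.edges.toFinset) := by
    rw [bicyclicEdges, himg]
    simp [hi, hj]
  dsimp only
  rw [hE]
  constructor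
  · rw [Finset.card_insert_of_notMem, Finset.card_insert_of_notMem,
      List.toFinset_card_of_nodup hw.isTrail.edges_nodup, SimpleGraph.Walk.length_edges]
    · simpa using h2
    · simp only [Finset.mem_insert, List.mem_toFinset, not_or]; exact ⟨h3, h1⟩
  · intro e he
    simp only [Finset.mem_insert, List.mem_toFinset] at he
    rcases he with rfl | rfl | he
    · exact hax
    · exact hby
    · exact w.edges_subset_edgeSet he

theorem SimpleGraph.binomialRandom_subset_edgeSet_le {V : Type*} [Countable V] (q : unitInterval)
    (E : Finset (Sym2 V)) :
    SimpleGraph.binomialRandom V q {G | ∀ e ∈ E, e ∈ G.edgeSet} ≤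
      (unitInterval.toNNReal q : ENNReal) ^ E.card := by
  rw [SimpleGraph.binomialRandom_apply']
  calc _ ≤ ProbabilityTheory.setBernoulli Sym2.diagSetᶜ q {s : Set (Sym2 V) | ∀ e ∈ E, e ∈ s} := by
        refine measure_mono ?_
        rintro s ⟨G, hG, rfl⟩
        exact hG
    _ = Measure.infinitePi (fun i : Sym2 V => unitInterval.toNNReal q •
          Measure.dirac (i ∈ Sym2.diagSetᶜ) +
          unitInterval.toNNReal (unitInterval.symm q) • Measure.dirac False)
          (Set.pi (E : Set (Sym2 V)) fun _ => {True}) := by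
        rw [ProbabilityTheory.setBernoulli_apply']
        congr 1
        ext f
        simp
    _ ≤ _ := by
        rw [Measure.infinitePi_pi _ (fun _ _ => MeasurableSet.of_discrete), ← Finset.prod_const]
        refine Finset.prod_le_prod' fun e _ => ?_
        rw [Measure.add_apply, Measure.smul_apply, Measure.smul_apply]
        have h1 : (Measure.dirac False : Measure Prop) {True} = 0 := by simp
        rw [h1, smul_zero, add_zero, ENNReal.smul_def, smul_eq_mul]
        exact mul_le_of_le_one_right' prob_le_one

theorem tsum_sq_mul_pow_ne_top {ρ : NNReal} (hρ : ρ < 1) :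
    ∑' m : ℕ, ((m : ENNReal) + 1) ^ 2 * (ρ : ENNReal) ^ (m + 2) ≠ ⊤ := by
  have h : Summable fun m : ℕ => ((m : NNReal) + 1) ^ 2 * ρ ^ (m + 1) := by
    rw [← NNReal.summable_coe]
    have := summable_pow_mul_geometric_of_norm_lt_one (R := ℝ) 2 (r := (ρ : ℝ)) (by simpa using hρ)
    have := (summable_nat_add_iff 1).2 this
    simpa using this
  have h2 : Summable fun m : ℕ => ((m : NNReal) + 1) ^ 2 * ρ ^ (m + 2) := by
    exact (h.mul_left ρ).congr fun m => by ring
  have := ENNReal.tsum_coe_ne_top_iff_summable.2 h2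
  simpa using this

/-- Union bound: a bicyclic configuration has `m + 1` vertices but `m + 2` edges, so the extra
factor `N` on the left is exactly what balances the powers of `N` and `Q`. -/
theorem card_mul_binomialRandom_hasBicyclicPath_le {V : Type*} [Fintype V] (q : unitInterval)
    {ρ : NNReal} (hq : Fintype.card V * unitInterval.toNNReal q ≤ ρ) :
    (Fintype.card V : ENNReal) * SimpleGraph.binomialRandom V q {G | G.HasBicyclicPath} ≤
      ∑' m : ℕ, ((m : ENNReal) + 1) ^ 2 * (ρ : ENNReal) ^ (m + 2) := by
  classical
  set N : ENNReal := (Fintype.card V : ENNReal) with hN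
  set Q : ENNReal := (unitInterval.toNNReal q : ENNReal) with hQ
  have hNQ : N * Q ≤ ρ := by
    rw [hN, hQ]; exact_mod_cast hq
  -- Only the number of distinct edges matters for the probability; injectivity of the vertex
  -- sequence is dropped, which merely overcounts.
  set T : (m : ℕ) → Finset ((Fin (m + 1) → V) × Fin (m + 1) × Fin (m + 1)) := fun m =>
    Finset.univ.filter fun x => (bicyclicEdges x.1 x.2.1 x.2.2).card = m + 2 with hT
  have hsub : {G : SimpleGraph V | G.HasBicyclicPath} ⊆ ⋃ m, ⋃ x ∈ T m,
      {G : SimpleGraph V | ∀ e ∈ bicyclicEdges x.1 x.2.1 x.2.2, e ∈ G.edgeSet} := by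
    intro G hG
    obtain ⟨m, x, hx, hxG⟩ := SimpleGraph.HasBicyclicPath.exists_bicyclicEdges hG
    exact Set.mem_iUnion.2 ⟨m, Set.mem_iUnion₂.2 ⟨x, by simp [hT, hx], hxG⟩⟩
  refine (mul_le_mul_right ((measure_mono hsub).trans (measure_iUnion_le _)) N).trans ?_
  rw [← ENNReal.tsum_mul_left]
  refine ENNReal.tsum_le_tsum fun m => ?_
  have hm : SimpleGraph.binomialRandom V q (⋃ x ∈ T m,
      {G : SimpleGraph V | ∀ e ∈ bicyclicEdges x.1 x.2.1 x.2.2, e ∈ G.edgeSet}) ≤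
      N ^ (m + 1) * ((m : ENNReal) + 1) ^ 2 * Q ^ (m + 2) := by
    refine (measure_biUnion_finset_le _ _).trans ?_
    calc _ ≤ ∑ x ∈ T m, Q ^ (m + 2) := by
          refine Finset.sum_le_sum fun x hx => ?_
          refine (SimpleGraph.binomialRandom_subset_edgeSet_le q _).trans_eq ?_
          rw [(Finset.mem_filter.1 hx).2]
      _ = (T m).card * Q ^ (m + 2) := by rw [Finset.sum_const, nsmul_eq_mul]
      _ ≤ _ := by
          refine mul_le_mul_left ?_ _
          have : (T m).card ≤ Fintype.card V ^ (m + 1) * (m + 1) ^ 2 := by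
            refine (Finset.card_le_univ _).trans_eq ?_
            simp [sq]
          rw [hN]
          exact_mod_cast this
  calc _ ≤ N * (N ^ (m + 1) * ((m : ENNReal) + 1) ^ 2 * Q ^ (m + 2)) := mul_le_mul_right hm N
    _ = ((m : ENNReal) + 1) ^ 2 * (N * Q) ^ (m + 2) := by rw [mul_pow]; ring
    _ ≤ _ := by gcongr

/-! ### Unions of independent random graphs. -/

theorem SimpleGraph.IsOrientable.sup {V : Type*} {G H : SimpleGraph V} {k l : ℕ}
    (hG : G.IsOrientable k) (hH : H.IsOrientable l) : (G ⊔ H).IsOrientable (k + l) := by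
  obtain ⟨r, hr, hrk⟩ := hG
  obtain ⟨s, hs, hsl⟩ := hH
  refine ⟨fun u v => r u v ∨ s u v, fun u v h => ?_, fun u => ?_⟩
  · rcases h with h | h
    · exact (hr u v h).imp Or.inl Or.inl
    · exact (hs u v h).imp Or.inr Or.inr
  · calc {v | r u v ∨ s u v}.encard ≤ {v | r u v}.encard + {v | s u v}.encard :=
        Set.encard_union_le _ _
      _ ≤ k + l := add_le_add (hrk u) (hsl u)
      _ = _ := by push_cast; rfl

open unitInterval in
/-- The law of the indicator of an element present with probability `q` if `a` holds and absent
otherwise. -/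
noncomputable def bernoulliProp (a : Prop) (q : I) : Measure Prop :=
  toNNReal q • Measure.dirac a + toNNReal (σ q) • Measure.dirac False

open unitInterval in
theorem coe_toNNReal_add_symm (q : I) :
    (toNNReal q : ENNReal) + (toNNReal (σ q) : ENNReal) = 1 := by
  rw [← ENNReal.coe_add, ENNReal.coe_eq_one]
  ext
  simp

open unitInterval in
theorem bernoulliProp_apply (a : Prop) (q : I) (S : Set Prop) :
    bernoulliProp a q S = (toNNReal q : ENNReal) * Measure.dirac a S +
      (toNNReal (σ q) : ENNReal) * Measure.dirac False S := by
  rw [bernoulliProp, Measure.add_apply, Measure.smul_apply, Measure.smul_apply,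
    ENNReal.smul_def, ENNReal.smul_def, smul_eq_mul, smul_eq_mul]

instance (a : Prop) (q : unitInterval) : IsProbabilityMeasure (bernoulliProp a q) where
  measure_univ := by
    rw [bernoulliProp_apply, measure_univ, measure_univ, mul_one, mul_one, coe_toNNReal_add_symm]

open unitInterval in
theorem bernoulliProp_singleton_false (a : Prop) (q : I) :
    bernoulliProp a q {False} = (toNNReal q : ENNReal) * Measure.dirac a {False} +
      (toNNReal (σ q) : ENNReal) := by
  rw [bernoulliProp_apply]; simp

-- A probability measure on `Prop` is determined by its mass at `False`, and a disjunction fails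
-- exactly when both independent terms fail.
open unitInterval in
theorem bernoulliProp_or (a : Prop) (p q : I) :
    ((bernoulliProp a p).prod (bernoulliProp a q)).map (fun x => x.1 ∨ x.2) =
      bernoulliProp a (σ (σ p * σ q)) := by
  have hmeas : Measurable fun x : Prop × Prop => x.1 ∨ x.2 := Measurable.of_discrete
  have hprob : IsProbabilityMeasure
      (((bernoulliProp a p).prod (bernoulliProp a q)).map (fun x => x.1 ∨ x.2)) :=
    Measure.isProbabilityMeasure_map hmeas.aemeasurable
  have hfalse : ((bernoulliProp a p).prod (bernoulliProp a q)).map (fun x => x.1 ∨ x.2) {False} =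
      bernoulliProp a (σ (σ p * σ q)) {False} := by
    rw [Measure.map_apply hmeas (MeasurableSet.of_discrete)]
    have : (fun x : Prop × Prop => x.1 ∨ x.2) ⁻¹' {False} = {False} ×ˢ {False} := by
      ext ⟨x, y⟩; simp
    rw [this, Measure.prod_prod]
    by_cases ha : a
    · simp only [bernoulliProp_singleton_false, ha, MeasurableSet.of_discrete,
        Measure.dirac_apply', symm_symm]
      simp only [Set.mem_singleton_iff, eq_iff_iff, iff_false, not_true_eq_false,
        not_false_eq_true, Set.indicator_of_notMem, mul_zero, zero_add]
      rw [← ENNReal.coe_mul]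
      congr 1
    · simp only [bernoulliProp_singleton_false, ha, MeasurableSet.of_discrete,
        Measure.dirac_apply', Set.mem_singleton_iff, Set.indicator_of_mem, Pi.one_apply, mul_one,
        coe_toNNReal_add_symm]
  refine Measure.ext_of_singleton fun b => ?_
  have htrue : ({True} : Set Prop) = {False}ᶜ := by ext x; simp
  by_cases hb : b
  · have : b = True := by simp [hb]
    rw [this, htrue, prob_compl_eq_one_sub MeasurableSet.of_discrete,
      prob_compl_eq_one_sub MeasurableSet.of_discrete, hfalse]
  · have : b = False := by simp [hb]
    rw [this, hfalse]

theorem binomialRandom_eq_map_pi (V : Type*) [Fintype V] (q : unitInterval) :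
    SimpleGraph.binomialRandom V q =
      (Measure.pi fun e : Sym2 V => bernoulliProp (e ∈ Sym2.diagSetᶜ) q).map
        (fun f => SimpleGraph.fromEdgeSet {e | f e}) := by
  classical
  rw [SimpleGraph.binomialRandom_eq_map, ProbabilityTheory.setBernoulli_eq_map,
    Measure.map_map SimpleGraph.measurable_fromEdgeSet (by fun_prop)]
  rw [← Measure.infinitePi_eq_pi]
  rfl

theorem measurable_fromEdgeSet_setOf (V : Type*) :
    Measurable fun f : Sym2 V → Prop => SimpleGraph.fromEdgeSet {e | f e} :=
  SimpleGraph.measurable_fromEdgeSet.comp (by fun_prop)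

-- The union is taken edge by edge, so this reduces to `bernoulliProp_or` in each coordinate of the
-- product measure.
open unitInterval in
theorem binomialRandom_map_sup (V : Type*) [Fintype V] (p q : I) (S : Set (SimpleGraph V)) :
    SimpleGraph.binomialRandom V (σ (σ p * σ q)) S =
      ((SimpleGraph.binomialRandom V p).prod (SimpleGraph.binomialRandom V q))
        {x | x.1 ⊔ x.2 ∈ S} := by
  classical
  set μ : Sym2 V → Measure Prop := fun e => bernoulliProp (e ∈ Sym2.diagSetᶜ) p
  set ν : Sym2 V → Measure Prop := fun e => bernoulliProp (e ∈ Sym2.diagSetᶜ) q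
  have hmeas := measurable_fromEdgeSet_setOf V
  have hor : ∀ _ : Sym2 V, Measurable fun x : Prop × Prop => x.1 ∨ x.2 :=
    fun _ => Measurable.of_discrete
  have hpi : (Measure.pi fun e : Sym2 V => bernoulliProp (e ∈ Sym2.diagSetᶜ) (σ (σ p * σ q))) =
      (Measure.pi fun e => (μ e).prod (ν e)).map fun x e => (x e).1 ∨ (x e).2 := by
    have hprob : ∀ e, IsProbabilityMeasure (((μ e).prod (ν e)).map fun x => x.1 ∨ x.2) :=
      fun e => Measure.isProbabilityMeasure_map (hor e).aemeasurable
    rw [Measure.pi_map_pi fun e => (hor e).aemeasurable]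
    simp only [μ, ν, bernoulliProp_or]
  have hpair := (measurePreserving_arrowProdEquivProdArrow Prop Prop (Sym2 V) μ ν).map_eq
  have hm : Measurable fun (x : Sym2 V → Prop × Prop) e => (x e).1 ∨ (x e).2 :=
    measurable_pi_lambda _ fun e => (hor e).comp (measurable_pi_apply e)
  have hS : ∀ T : Set (SimpleGraph V), MeasurableSet T := fun T =>
    SimpleGraph.measurableEmbedding_edgeSet.measurableSet_image.1 MeasurableSet.of_discrete
  have hS2 : MeasurableSet {x : SimpleGraph V × SimpleGraph V | x.1 ⊔ x.2 ∈ S} := by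
    have : {x : SimpleGraph V × SimpleGraph V | x.1 ⊔ x.2 ∈ S} =
        ⋃ G : SimpleGraph V, {G} ×ˢ {H | G ⊔ H ∈ S} := by
      ext ⟨G, H⟩; simp
    rw [this]
    exact MeasurableSet.iUnion fun G => (hS _).prod (hS _)
  rw [binomialRandom_eq_map_pi, binomialRandom_eq_map_pi, binomialRandom_eq_map_pi, hpi,
    Measure.map_map hmeas hm, Measure.map_prod_map _ _ hmeas hmeas, ← hpair,
    Measure.map_map (hmeas.prodMap hmeas) (MeasurableEquiv.measurable _),
    Measure.map_apply (hmeas.comp hm) (hS S),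
    Measure.map_apply ((hmeas.prodMap hmeas).comp (MeasurableEquiv.measurable _)) hS2]
  congr 1
  ext x
  simp only [Set.mem_preimage, Function.comp_apply, Set.mem_ofPred_eq, Prod.map]
  rw [← SimpleGraph.fromEdgeSet_union]
  rfl

open unitInterval in
theorem binomialRandom_not_isOrientable_le (V : Type*) [Fintype V] (q : I) (k : ℕ) :
    SimpleGraph.binomialRandom V (σ (σ q ^ k)) {G | ¬ G.IsOrientable k} ≤
      k * SimpleGraph.binomialRandom V q {G | ¬ G.IsOrientable 1} := by
  induction k with
  | zero =>
    have h : (⊥ : SimpleGraph V).IsOrientable 0 := ⟨fun _ _ => False, by simp, by simp⟩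
    have hS : ∀ T : Set (SimpleGraph V), MeasurableSet T := fun T =>
      SimpleGraph.measurableEmbedding_edgeSet.measurableSet_image.1 MeasurableSet.of_discrete
    rw [pow_zero, symm_one, SimpleGraph.binomialRandom_zero, Measure.dirac_apply' _ (hS _)]
    simp [h]
  | succ k ih =>
    have : σ (σ q ^ (k + 1)) = σ (σ (σ (σ q ^ k)) * σ q) := by rw [symm_symm, pow_succ]
    rw [this, binomialRandom_map_sup]
    set μ := SimpleGraph.binomialRandom V (σ (σ q ^ k))
    set ν := SimpleGraph.binomialRandom V q
    calc _ ≤ (μ.prod ν) ({G | ¬ G.IsOrientable k} ×ˢ Set.univ ∪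
          Set.univ ×ˢ {G | ¬ G.IsOrientable 1}) := by
          refine measure_mono ?_
          rintro ⟨G, H⟩ h
          by_contra hcon
          simp only [Set.mem_union, Set.mem_prod, Set.mem_ofPred_eq, Set.mem_univ, and_true,
            true_and, not_or, not_not] at hcon
          exact h (hcon.1.sup hcon.2)
      _ ≤ _ := measure_union_le _ _
      _ = μ {G | ¬ G.IsOrientable k} + ν {G | ¬ G.IsOrientable 1} := by
          rw [Measure.prod_prod, Measure.prod_prod]; simp [μ, ν]
      _ ≤ _ := by
          push_cast
          rw [add_mul, one_mul]
          gcongr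

/-! ### Edge probability of the copies, and the limit. -/

open unitInterval in
theorem exists_symm_pow_eq (P : I) {k : ℕ} (hk : 0 < k) : ∃ q : I, σ (σ q ^ k) = P := by
  have h0 : (0 : ℝ) ≤ σ P := (σ P).2.1
  set t : I := ⟨((σ P : I) : ℝ) ^ ((k : ℝ)⁻¹), Real.rpow_nonneg h0 _,
    Real.rpow_le_one h0 (σ P).2.2 (by positivity)⟩ with ht
  have htk : t ^ k = σ P := by
    ext
    exact Real.rpow_inv_natCast_pow h0 hk.ne'
  exact ⟨σ t, by rw [symm_symm, htk, symm_symm]⟩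

/-- If `1 - (1 - q) ^ k = p / n` with `p < k r`, then `n q ≤ r` for large `n`. -/
theorem eventually_card_mul_le {p r : ℝ} (hp : 0 < p) (hr : 0 < r) {k : ℕ} (hk : 0 < k)
    (hpr : p < k * r) :
    ∀ᶠ n : ℕ in atTop, ∀ q : unitInterval,
      unitInterval.symm (unitInterval.symm q ^ k) = edgeProb p n → (n : ℝ) * q ≤ r := by
  -- Precisely the threshold beyond which `(1 - p / n) * (1 + k * (r / n)) ≥ 1`.
  have hev : ∀ᶠ n : ℕ in atTop, p * (k * r) / (k * r - p) ≤ (n : ℝ) :=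
    tendsto_natCast_atTop_atTop.eventually_ge_atTop _
  filter_upwards [hev, tendsto_natCast_atTop_atTop.eventually_ge_atTop (max p r),
    eventually_gt_atTop 0] with n hn hn2 hn0 q hq
  have hn' : (0 : ℝ) < n := by exact_mod_cast hn0
  have hpn : p ≤ n := (le_max_left _ _).trans hn2
  have hrn : r ≤ n := (le_max_right _ _).trans hn2
  have hq' := congrArg (fun x : unitInterval => (x : ℝ)) hq
  have hedge : (edgeProb p n : ℝ) = p / n := by
    rw [edgeProb, Set.projIcc_of_mem _ ⟨by positivity, (div_le_one hn').2 hpn⟩]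
  have hcoe : ((unitInterval.symm q ^ k : unitInterval) : ℝ) = (1 - (q : ℝ)) ^ k := rfl
  simp only [unitInterval.coe_symm_eq, hcoe, hedge] at hq'
  rw [div_le_iff₀ (by linarith)] at hn
  -- Bernoulli's inequality bounds `(1 + r / n) ^ k` from below, giving an upper bound for `(1 - r /
  -- n) ^ k` to compare with `1 - p / n`.
  have hb : (1 - r / n) ^ k * (1 + k * (r / n)) ≤ 1 := by
    have h1 : 0 ≤ 1 - r / n := sub_nonneg.2 ((div_le_one hn').2 hrn)
    have h2 : 1 + k * (r / n) ≤ (1 + r / n) ^ k :=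
      one_add_mul_le_pow (by have : 0 ≤ r / n := by positivity
                             linarith) k
    calc _ ≤ (1 - r / n) ^ k * (1 + r / n) ^ k := by gcongr
      _ = (1 - (r / n) ^ 2) ^ k := by rw [← mul_pow]; ring
      _ ≤ 1 := pow_le_one₀ (by
          have : r / n ≤ 1 := (div_le_one hn').2 hrn
          have h0 : 0 ≤ r / n := by positivity
          nlinarith) (by nlinarith [sq_nonneg (r / n)])
  have hlow : (1 - r / n) ^ k ≤ (1 - (q : ℝ)) ^ k := by
    have e : (1 - (q : ℝ)) ^ k = 1 - p / n := by linarith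
    rw [e]
    have hpos : 0 < 1 + k * (r / n) := by positivity
    refine le_of_mul_le_mul_right (hb.trans ?_) hpos
    have : (1 - p / n) * (1 + k * (r / n)) - 1 = (n * (k * r - p) - p * (k * r)) / n ^ 2 := by
      field_simp; ring
    have h0 : 0 ≤ (n * (k * r - p) - p * (k * r)) / (n : ℝ) ^ 2 :=
      div_nonneg (by linarith) (by positivity)
    linarith
  have hq1 : 0 ≤ 1 - (q : ℝ) := sub_nonneg.2 q.2.2
  have := le_of_pow_le_pow_left₀ hk.ne' hq1 hlow
  have h3 : (q : ℝ) ≤ r / n := by linarith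
  rw [mul_comm]
  exact (le_div_iff₀ hn').1 h3

theorem mainTheorem4 (c p : ℝ) (hc : 0 < c) (hp : 0 < p) (k : ℕ) (hk : k = ⌊p⌋₊ + 1) :
    Tendsto
      (fun n : ℕ =>
        (SimpleGraph.binomialRandom (Fin n) (edgeProb p n))
          {G : SimpleGraph (Fin n) |
            realMatrixSpectralRadius (regularizedWalkMatrix c G) ≤
              ENNReal.ofReal (tauBound (c / (k : ℝ)))})
      atTop (𝓝 1) := by
  have hk0 : 0 < k := by omega
  have hk0' : (0 : ℝ) < k := by exact_mod_cast hk0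
  have hpk : p < k := by rw [hk]; push_cast; exact Nat.lt_floor_add_one p
  -- The choice `k = ⌊p⌋₊ + 1` enters only through `p / k < 1`; the gap leaves room for `n * q` to
  -- exceed `p / k` slightly.
  obtain ⟨r, hr1, hr2⟩ := exists_between ((div_lt_one hk0').2 hpk)
  have hr0 : 0 < r := (div_pos hp hk0').trans hr1
  set ρ : NNReal := ⟨r, hr0.le⟩ with hρ
  have hρ1 : ρ < 1 := by rw [← NNReal.coe_lt_coe]; exact hr2
  set C : ENNReal := ∑' m : ℕ, ((m : ENNReal) + 1) ^ 2 * (ρ : ENNReal) ^ (m + 2) with hC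
  have hCtop : C ≠ ⊤ := tsum_sq_mul_pow_ne_top hρ1
  have hlower : Tendsto (fun n : ℕ => 1 - k * (C / n)) atTop (𝓝 (1 : ENNReal)) := by
    have h1 : Tendsto (fun n : ℕ => C / (n : ENNReal)) atTop (𝓝 0) := by
      simpa using ENNReal.Tendsto.const_div ENNReal.tendsto_nat_nhds_top (Or.inr hCtop)
    have h2 := ENNReal.Tendsto.const_mul (a := (k : ENNReal)) h1
      (Or.inr (ENNReal.natCast_ne_top k))
    simpa using ENNReal.Tendsto.sub (tendsto_const_nhds (x := (1 : ENNReal))) h2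
      (Or.inl ENNReal.one_ne_top)
  refine tendsto_of_tendsto_of_tendsto_of_le_of_le' hlower tendsto_const_nhds ?_
    (Eventually.of_forall fun n => prob_le_one)
  have hpr : p < k * r := by rw [mul_comm]; exact (div_lt_iff₀ hk0').1 hr1
  filter_upwards [eventually_card_mul_le hp hr0 hk0 hpr, eventually_gt_atTop 0] with n hn hn0
  obtain ⟨q, hq⟩ := exists_symm_pow_eq (edgeProb p n) hk0
  have hnq : Fintype.card (Fin n) * unitInterval.toNNReal q ≤ ρ := by
    have hρr : (ρ : ℝ) = r := rfl
    rw [← NNReal.coe_le_coe, hρr]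
    simpa using hn q hq
  have hbi := card_mul_binomialRandom_hasBicyclicPath_le q hnq
  rw [Fintype.card_fin, ← hC] at hbi
  have hbi' : SimpleGraph.binomialRandom (Fin n) q {G | ¬ G.IsOrientable 1} ≤ C / n := by
    rw [ENNReal.le_div_iff_mul_le (Or.inl (by simpa using hn0.ne'))
      (Or.inl (ENNReal.natCast_ne_top n)), mul_comm]
    refine le_trans ?_ hbi
    gcongr with G
    intro hG
    by_contra h
    exact hG (SimpleGraph.isOrientable_one_of_not_hasBicyclicPath h)
  have hbad : SimpleGraph.binomialRandom (Fin n) (edgeProb p n) {G | ¬ G.IsOrientable k} ≤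
      k * (C / n) := by
    rw [← hq]
    exact (binomialRandom_not_isOrientable_le _ q k).trans (by gcongr)
  have hone : 1 ≤ SimpleGraph.binomialRandom (Fin n) (edgeProb p n) {G | G.IsOrientable k} +
      SimpleGraph.binomialRandom (Fin n) (edgeProb p n) {G | ¬ G.IsOrientable k} := by
    rw [← measure_univ (μ := SimpleGraph.binomialRandom (Fin n) (edgeProb p n))]
    refine (measure_mono ?_).trans (measure_union_le _ _)
    intro G _
    exact em _
  rw [tsub_le_iff_right]
  refine hone.trans (add_le_add (measure_mono ?_) hbad)
  intro G hG
  exact spectralRadius_le_tauBound_of_orientable hk0 hG hc
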